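/- Let $X$ be a compact subset of $\mathbb C$. A path in $X$ is a continuous map $\gamma:[a,b]\to X$ with $a<b$; its endpoints are $\gamma^-=\gamma(a)$ and $\gamma^+=\gamma(b)$. A rectifiable Jordan arc in $X$ is the image of an injective rectifiable path in $X$. Suppose that $X$ is semi-rectifiable, i.e. that the union of all the rectifiable Jordan arcs in $X$ is dense in $X$ (so $X$ is perfect). Write $C(X)$ for the algebra of continuous complex-valued functions on $X$, with the uniform norm $|\cdot|_X$. Let $D^{(1)}(X)$ be the algebra of those $f\in C(X)$ for which the complex derivative $f'(a)=\lim_{z\to a,\,z\in X}\frac{f(z)-f(a)}{z-a}$ exists at each $a\in X$ and is continuous on $X$, with the norm $\|f\|=|f|_X+|f'|_X$, and let $\widetilde D^{(1)}(X)$ be its completion. Let $\mathcal F$ be the family of all admissible paths in $X$, i.e. of the rectifiable paths in $X$ that are not constant on any non-degenerate closed subinterval of their parameter interval. Call $g\in C(X)$ an $\mathcal F$-derivative of $f\in C(X)$ if $\int_\gamma g(z)\,dz=f(\gamma^+)-f(\gamma^-)$ for all $\gamma\in\mathcal F$ (a Riemann–Stieltjes integral), and let $D^{(1)}_{\mathcal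 F}(X)$ be the set of all $f\in C(X)$ that have an $\mathcal F$-derivative in $C(X)$. Then: 1. $\widetilde D^{(1)}(X)$ is semisimple, i.e. its Jacobson radical is $\{0\}$. 2. $\mathcal F$-derivatives are unique, and with the norm $\|f\|=|f|_X+|f'|_X$, where $f'$ now denotes the $\mathcal F$-derivative of $f$, $D^{(1)}_{\mathcal F}(X)$ is a Banach function algebra on $X$: it is a subalgebra of $C(X)$ that contains the constants and separates the points of $X$, and $\|\cdot\|$ is a complete algebra norm on it with $\|f\|\ge|f|_X$. 3. The inclusion $D^{(1)}(X)\subseteq C(X)$ extends to an isometric algebra embedding of $\widetilde D^{(1)}(X)$ into $D^{(1)}_{\mathcal F}(X)$. -/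

import Mathlib

open Set Filter Topology

noncomputable section

/-- A path in a plane set `X`: a continuous map `[a, b] → X` with `a < b`. -/
structure PlanePath (X : Set ℂ) where
  a : ℝ
  b : ℝ
  lt : a < b
  toFun : C(Icc a b, X)

namespace PlanePath

variable {X : Set ℂ}

/-- The left endpoint of the parameter interval. -/
def left (γ : PlanePath X) : Icc γ.a γ.b := ⟨γ.a, left_mem_Icc.2 γ.lt.le⟩

/-- The right endpoint of the parameter interval. -/
def right (γ : PlanePath X) : Icc γ.a γ.b := ⟨γ.b, right_mem_Icc.2 γ.lt.le⟩

/-- The restriction of a path to the parameter interval `[c, d]`, where `c < d`. -/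
def subpath (γ : PlanePath X) (c d : Icc γ.a γ.b) (h : c < d) : PlanePath X where
  a := c
  b := d
  lt := h
  toFun := γ.toFun.comp
    ⟨Set.inclusion (Icc_subset_Icc c.2.1 d.2.2), continuous_inclusion _⟩

/-- The length of a path: its total variation, `∞` if the path is not rectifiable. -/
def length (γ : PlanePath X) : ENNReal := eVariationOn (γ.toFun : Icc γ.a γ.b → X) univ

/-- A path is rectifiable if it has finite length. -/
def IsRectifiable (γ : PlanePath X) : Prop := γ.length ≠ ⊤

/-- A path is constant if it takes only one value. -/
def IsConstant (γ : PlanePath X) : Prop := ∃ x : X, ∀ t, γ.toFun t = x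

/-- A path is admissible if it is rectifiable and has no constant subpath. -/
def IsAdmissible (γ : PlanePath X) : Prop :=
  γ.IsRectifiable ∧ ∀ (c d : Icc γ.a γ.b) (h : c < d), ¬ (γ.subpath c d h).IsConstant

/-- A Jordan path is an injective path. -/
def IsJordan (γ : PlanePath X) : Prop := Function.Injective γ.toFun

/-- `γ.HasIntegral g I` says that the Riemann--Stieltjes integral `∫_γ g(z) dz` exists and equals
`I`: the sums `∑ g(γ(sᵢ)) (γ(tᵢ₊₁) - γ(tᵢ))` over tagged partitions of the parameter interval
converge to `I` as the mesh of the partition tends to `0`. -/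
def HasIntegral (γ : PlanePath X) (g : C(X, ℂ)) (I : ℂ) : Prop :=
  ∀ ε > (0 : ℝ), ∃ δ > (0 : ℝ), ∀ (n : ℕ) (t s : ℕ → Icc γ.a γ.b),
    Monotone t → t 0 = γ.left → t n = γ.right →
    (∀ i < n, t i ≤ s i ∧ s i ≤ t (i + 1)) →
    (∀ i < n, (t (i + 1) : ℝ) - (t i : ℝ) < δ) →
    ‖(∑ i ∈ Finset.range n, g (γ.toFun (s i)) *
        ((γ.toFun (t (i + 1)) : ℂ) - (γ.toFun (t i) : ℂ))) - I‖ < ε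

end PlanePath

/-- `X` is semi-rectifiable if the union of all the rectifiable Jordan arcs in `X` is
dense in `X`. -/
def IsSemiRectifiable (X : Set ℂ) : Prop :=
  Dense (⋃ γ ∈ {γ : PlanePath X | γ.IsRectifiable ∧ γ.IsJordan}, range γ.toFun : Set X)

/-- The family of all admissible paths in `X`. -/
def admissiblePaths (X : Set ℂ) : Set (PlanePath X) := {γ | γ.IsAdmissible}

/-! ### The normed algebra of continuously differentiable functions -/

namespace ContDiffAlg

variable {X : Set ℂ}

/-- Extension of a function on `X` to the plane. The values off `X` play no role below. -/
def ext (f : C(X, ℂ)) : ℂ → ℂ := Function.extend Subtype.val f 0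

theorem ext_apply (f : C(X, ℂ)) {z : ℂ} (hz : z ∈ X) : ext f z = f ⟨z, hz⟩ :=
  Subtype.val_injective.extend_apply f 0 ⟨z, hz⟩

/-- `f` is continuously differentiable on `X`: at each `a ∈ X` the limit of
`(f z - f a) / (z - a)` as `z → a` within `X` exists, and it depends continuously on `a`.
(At an isolated point of `X` the value of `derivWithin` is `0`; a perfect set has none.) -/
def IsContDiff (f : C(X, ℂ)) : Prop :=
  DifferentiableOn ℂ (ext f) X ∧ ContinuousOn (derivWithin (ext f) X) X

theorem derivWithin_ext_const (c : ℂ) (z : ℂ) (hz : z ∈ X) :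
    HasDerivWithinAt (ext (algebraMap ℂ C(X, ℂ) c)) 0 X z :=
  (hasDerivWithinAt_const z X c).congr (fun w hw => by simp [ext_apply _ hw])
    (by simp [ext_apply _ hz])

theorem derivWithin_ext_add {f g : C(X, ℂ)} (hf : DifferentiableOn ℂ (ext f) X)
    (hg : DifferentiableOn ℂ (ext g) X) (z : ℂ) (hz : z ∈ X) :
    derivWithin (ext (f + g)) X z = derivWithin (ext f) X z + derivWithin (ext g) X z := by
  rw [← derivWithin_fun_add (hf z hz) (hg z hz)]
  exact derivWithin_congr (fun w hw => by simp [ext_apply _ hw]) (by simp [ext_apply _ hz])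

theorem derivWithin_ext_mul {f g : C(X, ℂ)} (hf : DifferentiableOn ℂ (ext f) X)
    (hg : DifferentiableOn ℂ (ext g) X) (z : ℂ) (hz : z ∈ X) :
    derivWithin (ext (f * g)) X z =
      derivWithin (ext f) X z * ext g z + ext f z * derivWithin (ext g) X z := by
  rw [← derivWithin_fun_mul (hf z hz) (hg z hz)]
  exact derivWithin_congr (fun w hw => by simp [ext_apply _ hw]) (by simp [ext_apply _ hz])

theorem continuousOn_ext (f : C(X, ℂ)) : ContinuousOn (ext f) X := by
  rw [continuousOn_iff_continuous_domRestrict]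
  convert f.continuous using 1
  ext z
  simp [ext_apply _ z.2]

theorem isContDiff_const (c : ℂ) : IsContDiff (algebraMap ℂ C(X, ℂ) c) :=
  ⟨fun z hz => (derivWithin_ext_const c z hz).differentiableWithinAt,
    (continuousOn_const (c := (0 : ℂ))).congr fun z hz => by
      by_cases h : UniqueDiffWithinAt ℂ X z
      · exact (derivWithin_ext_const c z hz).derivWithin h
      · exact derivWithin_zero_of_not_uniqueDiffWithinAt h⟩

theorem IsContDiff.add {f g : C(X, ℂ)} (hf : IsContDiff f) (hg : IsContDiff g) :
    IsContDiff (f + g) :=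
  ⟨(hf.1.fun_add hg.1).congr fun z hz => by simp [ext_apply _ hz],
    (hf.2.add hg.2).congr fun z hz => derivWithin_ext_add hf.1 hg.1 z hz⟩

theorem IsContDiff.mul {f g : C(X, ℂ)} (hf : IsContDiff f) (hg : IsContDiff g) :
    IsContDiff (f * g) :=
  ⟨(hf.1.fun_mul hg.1).congr fun z hz => by simp [ext_apply _ hz],
    ((hf.2.mul (continuousOn_ext g)).add ((continuousOn_ext f).mul hg.2)).congr
      fun z hz => derivWithin_ext_mul hf.1 hg.1 z hz⟩

/-- The continuously differentiable functions as a subalgebra of `C(X)`. -/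
def subalgebra (X : Set ℂ) : Subalgebra ℂ C(X, ℂ) where
  carrier := {f | IsContDiff f}
  mul_mem' := IsContDiff.mul
  add_mem' := IsContDiff.add
  algebraMap_mem' := isContDiff_const

end ContDiffAlg

/-- The algebra `D⁽¹⁾(X)` of continuously differentiable functions on `X`. It is a type of its own
because it carries the norm `|f|_X + |f'|_X`, not the uniform norm. -/
def D1 (X : Set ℂ) : Type := ContDiffAlg.subalgebra X

namespace D1

variable {X : Set ℂ}

instance : CommRing (D1 X) := inferInstanceAs (CommRing (ContDiffAlg.subalgebra X))

instance : Algebra ℂ (D1 X) := inferInstanceAs (Algebra ℂ (ContDiffAlg.subalgebra X))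

/-- The inclusion of `D⁽¹⁾(X)` in `C(X)`. -/
def toC : D1 X →ₐ[ℂ] C(X, ℂ) := (ContDiffAlg.subalgebra X).val

theorem toC_injective : Function.Injective (toC : D1 X → C(X, ℂ)) := Subtype.val_injective

theorem isContDiff (f : D1 X) : ContDiffAlg.IsContDiff (toC f) := f.2

/-- The complex derivative `f'` of `f ∈ D⁽¹⁾(X)`, as an element of `C(X)`. -/
def deriv (f : D1 X) : C(X, ℂ) :=
  ⟨X.domRestrict (derivWithin (ContDiffAlg.ext (toC f)) X), f.isContDiff.2.domRestrict⟩

theorem deriv_apply (f : D1 X) (z : X) :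
    f.deriv z = derivWithin (ContDiffAlg.ext (toC f)) X z := rfl

theorem deriv_algebraMap (c : ℂ) : deriv (algebraMap ℂ (D1 X) c) = 0 := by
  ext z
  rw [deriv_apply, AlgHom.commutes]
  by_cases h : UniqueDiffWithinAt ℂ X z
  · exact (ContDiffAlg.derivWithin_ext_const c z z.2).derivWithin h
  · exact derivWithin_zero_of_not_uniqueDiffWithinAt h

theorem deriv_add (f g : D1 X) : (f + g).deriv = f.deriv + g.deriv := by
  ext z
  simp only [deriv_apply, map_add, ContinuousMap.add_apply]
  exact ContDiffAlg.derivWithin_ext_add f.isContDiff.1 g.isContDiff.1 z z.2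

theorem deriv_mul (f g : D1 X) : (f * g).deriv = f.deriv * toC g + toC f * g.deriv := by
  ext z
  simp only [deriv_apply, map_mul, ContinuousMap.add_apply, ContinuousMap.mul_apply]
  rw [ContDiffAlg.derivWithin_ext_mul f.isContDiff.1 g.isContDiff.1 z z.2,
    ContDiffAlg.ext_apply _ z.2, ContDiffAlg.ext_apply _ z.2]

theorem deriv_zero : deriv (0 : D1 X) = 0 := by
  simpa using deriv_algebraMap (X := X) 0

theorem deriv_neg (f : D1 X) : (-f).deriv = -f.deriv := by
  rw [eq_neg_iff_add_eq_zero, ← deriv_add, neg_add_cancel, deriv_zero]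

theorem deriv_smul (c : ℂ) (f : D1 X) : (c • f).deriv = c • f.deriv := by
  rw [Algebra.smul_def, deriv_mul, deriv_algebraMap, AlgHom.commutes, zero_mul, zero_add,
    ← Algebra.smul_def]

variable [CompactSpace X]

/-- The norm `‖f‖ = |f|_X + |f'|_X`. -/
def addGroupNorm (X : Set ℂ) [CompactSpace X] : AddGroupNorm (D1 X) where
  toFun f := ‖toC f‖ + ‖f.deriv‖
  map_zero' := by simp [deriv_zero]
  add_le' f g := by
    rw [map_add, deriv_add]
    linarith [norm_add_le (toC f) (toC g), norm_add_le f.deriv g.deriv]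
  neg' f := by rw [map_neg, deriv_neg, norm_neg, norm_neg]
  eq_zero_of_map_eq_zero' f hf := by
    have h : ‖toC f‖ = 0 := by
      linarith [norm_nonneg (toC f), norm_nonneg f.deriv]
    exact toC_injective (by rw [norm_eq_zero.1 h, map_zero])

instance : NormedAddCommGroup (D1 X) := (addGroupNorm X).toNormedAddCommGroup

theorem norm_def (f : D1 X) : ‖f‖ = ‖toC f‖ + ‖f.deriv‖ := rfl

instance : NormedCommRing (D1 X) :=
  { (inferInstance : CommRing (D1 X)), (inferInstance : NormedAddCommGroup (D1 X)) with
    norm_mul_le := fun f g => by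
      have h₁ := norm_mul_le (toC f) (toC g)
      have h₂ := norm_add_le (f.deriv * toC g) (toC f * g.deriv)
      have h₃ := norm_mul_le f.deriv (toC g)
      have h₄ := norm_mul_le (toC f) g.deriv
      have h₅ := mul_nonneg (norm_nonneg f.deriv) (norm_nonneg g.deriv)
      simp only [norm_def, map_mul, deriv_mul]
      nlinarith }

instance : NormedAlgebra ℂ (D1 X) :=
  { (inferInstance : Algebra ℂ (D1 X)) with
    norm_smul_le := fun c f => by
      rw [norm_def, norm_def, map_smul, deriv_smul, norm_smul, norm_smul, mul_add] }

end D1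

/-! ### Derivatives with respect to a family of paths -/

/-- `g` is an `F`-derivative of `f`: `∫_γ g = f(γ⁺) - f(γ⁻)` for every path `γ` in `F`. -/
def IsFDerivative {X : Set ℂ} (F : Set (PlanePath X)) (f g : C(X, ℂ)) : Prop :=
  ∀ γ ∈ F, γ.HasIntegral g (f (γ.toFun γ.right) - f (γ.toFun γ.left))

/-- The space `D_F⁽¹⁾(X)` of the functions in `C(X)` with an `F`-derivative in `C(X)`. -/
def DF {X : Set ℂ} (F : Set (PlanePath X)) : Set C(X, ℂ) := {f | ∃ g, IsFDerivative F f g}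

open Classical in
/-- An `F`-derivative of `f`, when there is one. -/
def fDeriv {X : Set ℂ} (F : Set (PlanePath X)) (f : C(X, ℂ)) : C(X, ℂ) :=
  if h : ∃ g, IsFDerivative F f g then h.choose else 0

/-- The norm `‖f‖ = |f|_X + |f'|_X` of `D_F⁽¹⁾(X)`, with `f'` the `F`-derivative of `f`. -/
def fNorm {X : Set ℂ} [CompactSpace X] (F : Set (PlanePath X)) (f : C(X, ℂ)) : ℝ :=
  ‖f‖ + ‖fDeriv F f‖

/-- `(A, N)` is a Banach function algebra on the compact space `K`: `A` is a subalgebra of `C(K)`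
that contains the constants and separates the points of `K`, and `N` restricts to a complete
algebra norm on `A` that dominates the uniform norm. -/
structure IsBanachFunctionAlgebra {K : Type*} [TopologicalSpace K] [CompactSpace K]
    (A : Set C(K, ℂ)) (N : C(K, ℂ) → ℝ) : Prop where
  isSubalgebra : ∃ S : Subalgebra ℂ C(K, ℂ), (S : Set C(K, ℂ)) = A
  separates : ∀ x y : K, x ≠ y → ∃ f ∈ A, f x ≠ f y
  norm_le : ∀ f ∈ A, ‖f‖ ≤ N f
  smul : ∀ (c : ℂ), ∀ f ∈ A, N (c • f) = ‖c‖ * N f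
  add_le : ∀ f ∈ A, ∀ g ∈ A, N (f + g) ≤ N f + N g
  mul_le : ∀ f ∈ A, ∀ g ∈ A, N (f * g) ≤ N f * N g
  complete : ∀ u : ℕ → C(K, ℂ), (∀ n, u n ∈ A) →
    (∀ ε > (0 : ℝ), ∃ n₀, ∀ m ≥ n₀, ∀ n ≥ n₀, N (u m - u n) < ε) →
    ∃ f ∈ A, Tendsto (fun n => N (u n - f)) atTop (𝓝 0)

end

/-! Everything reduces to the pairs (f, g) in which g is an F-derivative of f. Such pairs turn out
to be closed under the product rule and under uniform limits, and f determines g. Along a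
rectifiable path the integral identity is traded for two estimates that measure errors by arc
length. `MeanValueBound` compares f with wz when g stays within K of w; `IsLocalDerivative` is its
infinitesimal form. The identity on all subpaths gives the first, uniform continuity of g gives the
second, and summing the second over a partition gives back the identity. Admissible paths are closed
under passing to subpaths, so for them the three conditions are equivalent. The mean value bound
involves no mesh and so passes to uniform limits; the local form suits sums, products and
uniqueness; a complex derivative yields the mean value bound by a local-to-global argument.
Uniqueness: if g₁ and g₂ differ at a point of a rectifiable Jordan arc, all chords near it are at
most half the arc they span. Summing, a short arc is at most half its own length, so it has length
0, against injectivity. Density of the arcs does the rest. On the completion, f and f' extend to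
limits that still form such a pair, and the norm is the sum of their uniform norms. By uniqueness
the first limit determines the second, so the map to C(X) is isometric for the F-norm, hence
injective; point evaluations then annihilate the radical. -/

noncomputable section

/-! ### Subdivision of compact intervals -/

/-- Induction on the subintervals of a compact interval: a predicate that passes to unions of
adjacent intervals and holds for all short intervals around each point holds for the interval. -/
theorem Icc_induction_of_local {a b : ℝ} (hab : a ≤ b) {P : ℝ → ℝ → Prop}
    (trans : ∀ c e d, a ≤ c → c ≤ e → e ≤ d → d ≤ b → P c e → P e d → P c d)
    (loc : ∀ t ∈ Icc a b, ∃ δ > 0, ∀ c ∈ Icc a b, ∀ d ∈ Icc a b,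
      c ≤ t → t ≤ d → t - δ < c → d < t + δ → P c d) : P a b := by
  set S : Set ℝ := {t | t ∈ Icc a b ∧ P a t} with hS
  have ha : a ∈ S := by
    obtain ⟨δ, hδ, h⟩ := loc a (left_mem_Icc.2 hab)
    exact ⟨left_mem_Icc.2 hab, h a (left_mem_Icc.2 hab) a (left_mem_Icc.2 hab) le_rfl le_rfl
      (by linarith) (by linarith)⟩
  have hbdd : BddAbove S := ⟨b, fun t ht => ht.1.2⟩
  have hax : a ≤ sSup S := le_csSup hbdd ha
  have hxb : sSup S ≤ b := csSup_le ⟨a, ha⟩ fun t ht => ht.1.2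
  obtain ⟨δ, hδ, h⟩ := loc (sSup S) ⟨hax, hxb⟩
  obtain ⟨c, hc, hlt⟩ := exists_lt_of_lt_csSup ⟨a, ha⟩ (sub_lt_self (sSup S) hδ)
  have hcx : c ≤ sSup S := le_csSup hbdd hc
  -- A point δ/2 beyond the supremum, cut off at b, still lies in S; so the supremum is b and is
  -- attained.
  have hxd : sSup S ≤ min (sSup S + δ / 2) b := le_min (by linarith) hxb
  have hdb : min (sSup S + δ / 2) b ≤ b := min_le_right _ _
  have hd : min (sSup S + δ / 2) b ∈ S := by
    refine ⟨⟨hax.trans hxd, hdb⟩, trans a c _ le_rfl hc.1.1 (hcx.trans hxd) hdb hc.2 ?_⟩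
    exact h c hc.1 _ ⟨hax.trans hxd, hdb⟩ hcx hxd hlt
      ((min_le_left _ _).trans_lt (by linarith))
  have hdx := le_csSup hbdd hd
  have : b ≤ sSup S := by
    rcases min_choice (sSup S + δ / 2) b with hm | hm <;> rw [hm] at hdx <;> linarith
  have hbe : min (sSup S + δ / 2) b = b := by
    rw [min_eq_right]; linarith
  rw [hbe] at hd
  exact hd.2

/-- A compact interval has monotone partitions of arbitrarily small mesh. -/
theorem exists_fine_partition {a b : ℝ} (hab : a ≤ b) {δ : ℝ} (hδ : 0 < δ) :
    ∃ (n : ℕ) (t : ℕ → Icc a b), Monotone t ∧ t 0 = ⟨a, left_mem_Icc.2 hab⟩ ∧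
      t n = ⟨b, right_mem_Icc.2 hab⟩ ∧ ∀ i, (t (i + 1) : ℝ) - t i < δ := by
  obtain ⟨n, hn⟩ := exists_nat_gt ((b - a) / (δ / 2))
  rw [div_lt_iff₀ (by positivity)] at hn
  -- Steps of δ/2, clipped at b; clipping does not enlarge gaps.
  refine ⟨n, fun i => projIcc a b hab (a + i * (δ / 2)), ?_, ?_, ?_, fun i => ?_⟩
  · intro i j hij
    apply monotone_projIcc
    have : (i : ℝ) ≤ j := by exact_mod_cast hij
    gcongr
  · simp
  · exact projIcc_of_right_le _ (by linarith)
  · have h := abs_projIcc_sub_projIcc (a := a) (b := b) hab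
      (c := a + (i + 1 : ℕ) * (δ / 2)) (d := a + i * (δ / 2))
    have h' : a + (i + 1 : ℕ) * (δ / 2) - (a + i * (δ / 2)) = δ / 2 := by push_cast; ring
    rw [h', abs_of_pos (half_pos hδ)] at h
    have := (le_abs_self _).trans h
    linarith

/-! ### Arc length and derivatives along a single path -/

namespace PlanePath

variable {X : Set ℂ} {γ : PlanePath X}

/-- The length of `γ` from its left endpoint to the parameter `t`. -/
def arcLength (γ : PlanePath X) (t : Icc γ.a γ.b) : ℝ :=
  variationOnFromTo γ.toFun univ γ.left t

theorem IsRectifiable.boundedVariationOn (hγ : γ.IsRectifiable) :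
    BoundedVariationOn (γ.toFun : Icc γ.a γ.b → X) univ := hγ

theorem IsRectifiable.arcLength_sub (hγ : γ.IsRectifiable) {c d : Icc γ.a γ.b} (h : c ≤ d) :
    γ.arcLength d - γ.arcLength c = (eVariationOn γ.toFun (Icc c d)).toReal := by
  rw [arcLength, arcLength, variationOnFromTo.sub_right hγ.boundedVariationOn.locallyBoundedVariationOn
    (mem_univ _) (mem_univ _) (mem_univ _), variationOnFromTo.eq_of_le _ _ h, univ_inter]

theorem IsRectifiable.arcLength_mono (hγ : γ.IsRectifiable) : Monotone γ.arcLength :=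
  fun _ _ h => sub_nonneg.1 (by rw [hγ.arcLength_sub h]; exact ENNReal.toReal_nonneg)

theorem IsRectifiable.norm_sub_le (hγ : γ.IsRectifiable) {c d : Icc γ.a γ.b} (h : c ≤ d) :
    ‖(γ.toFun d : ℂ) - γ.toFun c‖ ≤ γ.arcLength d - γ.arcLength c := by
  rw [hγ.arcLength_sub h, ← dist_eq_norm]
  exact (hγ.boundedVariationOn.mono (subset_univ _)).dist_le (right_mem_Icc.2 h) (left_mem_Icc.2 h)

/-- The increments of m telescope over each partition in the supremum that defines the variation.
Uniqueness uses this with m half the arc length. -/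
theorem IsRectifiable.arcLength_sub_le (hγ : γ.IsRectifiable) {c d : Icc γ.a γ.b} (h : c ≤ d)
    {m : Icc γ.a γ.b → ℝ} (hm : Monotone m)
    (H : ∀ u v, c ≤ u → u ≤ v → v ≤ d → ‖(γ.toFun v : ℂ) - γ.toFun u‖ ≤ m v - m u) :
    γ.arcLength d - γ.arcLength c ≤ m d - m c := by
  rw [hγ.arcLength_sub h]
  refine ENNReal.toReal_le_of_le_ofReal (sub_nonneg.2 (hm h)) (iSup_le ?_)
  rintro ⟨n, u, hu, hus⟩
  calc ∑ i ∈ Finset.range n, edist (γ.toFun (u (i + 1))) (γ.toFun (u i))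
      ≤ ∑ i ∈ Finset.range n, ENNReal.ofReal (m (u (i + 1)) - m (u i)) := by
        refine Finset.sum_le_sum fun i _ => ?_
        rw [edist_dist]
        refine ENNReal.ofReal_le_ofReal ?_
        rw [Subtype.dist_eq, dist_eq_norm]
        exact H _ _ (hus i).1 (hu i.le_succ) (hus (i + 1)).2
    _ = ENNReal.ofReal (m (u n) - m (u 0)) := by
        rw [← ENNReal.ofReal_sum_of_nonneg fun i _ => sub_nonneg.2 (hm (hu i.le_succ)),
          Finset.sum_range_sub fun i => m (u i)]
    _ ≤ ENNReal.ofReal (m d - m c) :=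
        ENNReal.ofReal_le_ofReal (sub_le_sub (hm (hus n).2) (hm (hus 0).1))

/-- The mean value inequality for `f` and `g` along `γ`. -/
def MeanValueBound (γ : PlanePath X) (f g : C(X, ℂ)) : Prop :=
  ∀ (c d : Icc γ.a γ.b) (w : ℂ) (K : ℝ), c ≤ d →
    (∀ u, c ≤ u → u ≤ d → ‖g (γ.toFun u) - w‖ ≤ K) →
    ‖f (γ.toFun d) - f (γ.toFun c) - w * ((γ.toFun d : ℂ) - γ.toFun c)‖ ≤
      K * (γ.arcLength d - γ.arcLength c)

/-- `g` is, uniformly along `γ`, a derivative of `f` relative to arc length. -/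
def IsLocalDerivative (γ : PlanePath X) (f g : C(X, ℂ)) : Prop :=
  ∀ ε > (0 : ℝ), ∃ δ > (0 : ℝ), ∀ c s d : Icc γ.a γ.b, c ≤ s → s ≤ d → (d : ℝ) - c < δ →
    ‖f (γ.toFun d) - f (γ.toFun c) - g (γ.toFun s) * ((γ.toFun d : ℂ) - γ.toFun c)‖ ≤
      ε * (γ.arcLength d - γ.arcLength c)

theorem exists_oscillation_le (γ : PlanePath X) (g : C(X, ℂ)) {ε : ℝ} (hε : 0 < ε) :
    ∃ δ > (0 : ℝ), ∀ c s u d : Icc γ.a γ.b, (d : ℝ) - c < δ → c ≤ s → s ≤ d → c ≤ u → u ≤ d →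
      ‖g (γ.toFun u) - g (γ.toFun s)‖ ≤ ε := by
  have hc : UniformContinuous fun t => g (γ.toFun t) :=
    CompactSpace.uniformContinuous_of_continuous (g.continuous.comp γ.toFun.continuous)
  obtain ⟨δ, hδ, h⟩ := Metric.uniformContinuous_iff.1 hc ε hε
  refine ⟨δ, hδ, fun c s u d hcd hs hs' hu hu' => ?_⟩
  rw [← dist_eq_norm]
  refine (h ?_).le
  rw [Subtype.dist_eq, Real.dist_eq, abs_lt]
  have h1 : (c : ℝ) ≤ s := hs
  have h2 : (s : ℝ) ≤ d := hs'
  have h3 : (c : ℝ) ≤ u := hu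
  have h4 : (u : ℝ) ≤ d := hu'
  constructor <;> linarith

/-- Freeze w at the value of g at the tag; on short intervals the oscillation of g serves as K. -/
theorem MeanValueBound.isLocalDerivative {f g : C(X, ℂ)} (h : γ.MeanValueBound f g) :
    γ.IsLocalDerivative f g := by
  intro ε hε
  obtain ⟨δ, hδ, H⟩ := γ.exists_oscillation_le g hε
  exact ⟨δ, hδ, fun c s d hs hs' hcd => h c d _ ε (hs.trans hs') fun u hu hu' =>
    H c s u d hcd hs hs' hu hu'⟩

/-- The increments of f telescope, and the errors add up to a small multiple of the total length. -/
theorem IsLocalDerivative.hasIntegral (hγ : γ.IsRectifiable) {f g : C(X, ℂ)}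
    (h : γ.IsLocalDerivative f g) :
    γ.HasIntegral g (f (γ.toFun γ.right) - f (γ.toFun γ.left)) := by
  intro ε hε
  have hL : 0 ≤ γ.arcLength γ.right - γ.arcLength γ.left :=
    sub_nonneg.2 (hγ.arcLength_mono γ.lt.le)
  set L := γ.arcLength γ.right - γ.arcLength γ.left with hLdef
  -- The summand 1 covers L = 0 and makes the final inequality strict.
  obtain ⟨δ, hδ, H⟩ := h (ε / (L + 1)) (by positivity)
  refine ⟨δ, hδ, fun n t s ht h0 hn hs hmesh => ?_⟩
  rw [← h0, ← hn, ← Finset.sum_range_sub fun i => f (γ.toFun (t i)), ← Finset.sum_sub_distrib]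
  calc _ ≤ ∑ i ∈ Finset.range n,
        ε / (L + 1) * (γ.arcLength (t (i + 1)) - γ.arcLength (t i)) := by
        refine norm_sum_le_of_le _ fun i hi => ?_
        rw [norm_sub_rev]
        have hi := Finset.mem_range.1 hi
        exact H _ _ _ (hs i hi).1 (hs i hi).2 (hmesh i hi)
    _ = ε / (L + 1) * L := by
        rw [← Finset.mul_sum, Finset.sum_range_sub fun i => γ.arcLength (t i), h0, hn]
    _ < ε := by
        rw [div_mul_eq_mul_div, div_lt_iff₀ (by positivity)]
        linarith

/-- The inclusion of the parameter interval of a subpath. -/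
def subParam (γ : PlanePath X) {c d : Icc γ.a γ.b} (u : Icc (c : ℝ) (d : ℝ)) : Icc γ.a γ.b :=
  Set.inclusion (Icc_subset_Icc c.2.1 d.2.2) u

/-- This closure property turns one identity per path into one per subinterval, which the mean value
bound needs. -/
theorem IsAdmissible.subpath (hγ : γ.IsAdmissible) (c d : Icc γ.a γ.b) (h : c < d) :
    (γ.subpath c d h).IsAdmissible := by
  refine ⟨ne_top_of_le_ne_top hγ.1 ?_, fun c' d' h' => ?_⟩
  · exact eVariationOn.comp_le_of_monotoneOn γ.toFun (γ.subParam (c := c) (d := d))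
      (fun _ _ _ _ h => h) (mapsTo_univ _ _)
  · exact hγ.2 (γ.subParam c') (γ.subParam d') h'

theorem IsRectifiable.isAdmissible_of_isJordan (hγ : γ.IsRectifiable) (hJ : γ.IsJordan) :
    γ.IsAdmissible := by
  refine ⟨hγ, fun c d h ⟨x, hx⟩ => h.ne (hJ ?_)⟩
  exact (hx (γ.subpath c d h).left).trans (hx (γ.subpath c d h).right).symm

/-- Riemann sums of the constant w are exact, and those of g - w are at most K times the arc length
because chords are shorter than arcs. -/
theorem meanValueBound_of_hasIntegral_subpath (hγ : γ.IsRectifiable) {f g : C(X, ℂ)}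
    (H : ∀ (c d : Icc γ.a γ.b) (h : c < d),
      (γ.subpath c d h).HasIntegral g (f (γ.toFun d) - f (γ.toFun c))) :
    γ.MeanValueBound f g := by
  intro c d w K hcd hK
  rcases hcd.eq_or_lt with rfl | hlt
  · simp
  refine le_of_forall_pos_le_add fun ε hε => ?_
  obtain ⟨δ, hδ, hI⟩ := H c d hlt ε hε
  obtain ⟨n, t, ht, h0, hn, hmesh⟩ := exists_fine_partition (a := c) (b := d) hcd hδ
  -- One fine partition suffices, tagged by its left endpoints.
  have hI := hI n t t ht h0 hn (fun i _ => ⟨le_rfl, ht i.le_succ⟩) fun i _ => hmesh i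
  set τ : ℕ → Icc γ.a γ.b := fun i => γ.subParam (t i) with hτ
  have hτm : Monotone τ := fun i j hij => ht hij
  have hτ0 : τ 0 = c := by simp only [hτ, h0]; rfl
  have hτn : τ n = d := by simp only [hτ, hn]; rfl
  change ‖(∑ i ∈ Finset.range n, g (γ.toFun (τ i)) *
    ((γ.toFun (τ (i + 1)) : ℂ) - (γ.toFun (τ i) : ℂ))) - _‖ < ε at hI
  have hS : ‖∑ i ∈ Finset.range n, (g (γ.toFun (τ i)) - w) *
      ((γ.toFun (τ (i + 1)) : ℂ) - γ.toFun (τ i))‖ ≤ K * (γ.arcLength d - γ.arcLength c) := by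
    calc _ ≤ ∑ i ∈ Finset.range n, K * (γ.arcLength (τ (i + 1)) - γ.arcLength (τ i)) := by
          refine norm_sum_le_of_le _ fun i _ => ?_
          rw [norm_mul]
          have h1 := hK (τ i) (t i).2.1 (t i).2.2
          exact mul_le_mul h1 (hγ.norm_sub_le (hτm i.le_succ)) (norm_nonneg _)
            ((norm_nonneg _).trans h1)
      _ = _ := by
          rw [← Finset.mul_sum, Finset.sum_range_sub fun i => γ.arcLength (τ i), hτ0, hτn]
  have hsplit : ∑ i ∈ Finset.range n, (g (γ.toFun (τ i)) - w) *
      ((γ.toFun (τ (i + 1)) : ℂ) - γ.toFun (τ i)) =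
      (∑ i ∈ Finset.range n, g (γ.toFun (τ i)) * ((γ.toFun (τ (i + 1)) : ℂ) - γ.toFun (τ i))) -
        w * ((γ.toFun d : ℂ) - γ.toFun c) := by
    simp_rw [sub_mul, Finset.sum_sub_distrib, ← Finset.mul_sum]
    rw [Finset.sum_range_sub fun i => (γ.toFun (τ i) : ℂ), hτ0, hτn]
  rw [hsplit] at hS
  rw [norm_sub_rev] at hI
  have := norm_add_le _ _ |>.trans (add_le_add hI.le hS)
  rw [sub_add_sub_cancel] at this
  linarith

theorem MeanValueBound.of_norm_sub_le {f g : C(X, ℂ)} (hγ : γ.IsRectifiable)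
    (H : ∀ ε > 0, ∃ f' g', γ.MeanValueBound f' g' ∧ (∀ x, ‖f x - f' x‖ ≤ ε) ∧
      ∀ x, ‖g x - g' x‖ ≤ ε) : γ.MeanValueBound f g := by
  intro c d w K hcd hK
  have hL : 0 ≤ γ.arcLength d - γ.arcLength c := sub_nonneg.2 (hγ.arcLength_mono hcd)
  set L := γ.arcLength d - γ.arcLength c
  refine le_of_forall_pos_le_add fun ε hε => ?_
  -- The error is charged L times for enlarging K and twice for the endpoint values of f.
  obtain ⟨f', g', h, hf, hg⟩ := H (ε / (L + 2)) (by positivity)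
  have h1 := h c d w (K + ε / (L + 2)) hcd fun u hu hu' => by
    have := norm_add_le (g (γ.toFun u) - w) (-(g (γ.toFun u) - g' (γ.toFun u)))
    rw [norm_neg] at this
    calc _ = ‖g (γ.toFun u) - w + -(g (γ.toFun u) - g' (γ.toFun u))‖ := by congr 1; ring
      _ ≤ _ := this
      _ ≤ _ := add_le_add (hK u hu hu') (hg _)
  have h2 : f (γ.toFun d) - f (γ.toFun c) - w * ((γ.toFun d : ℂ) - γ.toFun c) =
      (f' (γ.toFun d) - f' (γ.toFun c) - w * ((γ.toFun d : ℂ) - γ.toFun c)) +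
      (f (γ.toFun d) - f' (γ.toFun d)) - (f (γ.toFun c) - f' (γ.toFun c)) := by ring
  rw [h2]
  calc _ ≤ (K + ε / (L + 2)) * L + ε / (L + 2) + ε / (L + 2) :=
        (norm_sub_le _ _).trans (add_le_add ((norm_add_le _ _).trans (add_le_add h1 (hf _))) (hf _))
    _ = K * L + ε := by field_simp; ring

/-- The path need not be differentiable, so no chain rule applies. Instead differentiability at γ(t)
bounds the increments of f - wz from t by those of arc length, with K relaxed to K + η, and such
bounds add over adjacent intervals. -/
theorem MeanValueBound.of_hasDerivWithinAt (hγ : γ.IsRectifiable) {f g : C(X, ℂ)} {F : ℂ → ℂ}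
    (hF : ∀ x : X, F x = f x) (h : ∀ x : X, HasDerivWithinAt F (g x) X x) :
    γ.MeanValueBound f g := by
  intro c d w K hcd hK
  refine le_of_forall_pos_le_add fun ε hε => ?_
  have hL : 0 ≤ γ.arcLength d - γ.arcLength c := sub_nonneg.2 (hγ.arcLength_mono hcd)
  set η := ε / (γ.arcLength d - γ.arcLength c + 1) with hη
  have hη0 : 0 < η := by positivity
  set G : Icc γ.a γ.b → ℂ := fun t => f (γ.toFun t) - w * γ.toFun t with hG
  set I : ℝ → Icc γ.a γ.b := fun t => projIcc γ.a γ.b γ.lt.le t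
  have hI : Monotone I := monotone_projIcc _
  have hIc : I c = c := projIcc_val _ c
  have hId : I d = d := projIcc_val _ d
  have key : ‖G (I d) - G (I c)‖ ≤ (K + η) * (γ.arcLength (I d) - γ.arcLength (I c)) := by
    refine Icc_induction_of_local (P := fun c d => ‖G (I d) - G (I c)‖ ≤
      (K + η) * (γ.arcLength (I d) - γ.arcLength (I c))) hcd ?_ ?_
    · intro p q r _ _ _ _ h1 h2
      have := norm_sub_le_norm_sub_add_norm_sub (G (I r)) (G (I q)) (G (I p))
      linarith
    · intro t ht
      have hmem : I t ∈ Icc c d := ⟨hIc ▸ hI ht.1, hId ▸ hI ht.2⟩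
      have hbound : ∀ᶠ s in 𝓝 t, ‖G (I s) - G (I t)‖ ≤
          (K + η) * ‖(γ.toFun (I s) : ℂ) - γ.toFun (I t)‖ := by
        have h1 := (hasDerivWithinAt_iff_isLittleO.1 (h (γ.toFun (I t)))).def hη0
        have h2 : Tendsto (fun s => (γ.toFun (I s) : ℂ)) (𝓝 t) (𝓝[X] (γ.toFun (I t) : ℂ)) :=
          tendsto_nhdsWithin_iff.2 ⟨(continuous_subtype_val.comp
            (γ.toFun.continuous.comp continuous_projIcc)).continuousAt,
            Eventually.of_forall fun s => (γ.toFun (I s)).2⟩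
        filter_upwards [h2.eventually h1] with s hs
        rw [hF, hF, smul_eq_mul] at hs
        have h3 := hK (I t) hmem.1 hmem.2
        have h4 : G (I s) - G (I t) = (f (γ.toFun (I s)) - f (γ.toFun (I t)) -
            ((γ.toFun (I s) : ℂ) - γ.toFun (I t)) * g (γ.toFun (I t))) +
            (g (γ.toFun (I t)) - w) * ((γ.toFun (I s) : ℂ) - γ.toFun (I t)) := by
          simp only [hG]; ring
        rw [h4]
        refine (norm_add_le _ _).trans ?_
        rw [norm_mul]
        nlinarith [norm_nonneg ((γ.toFun (I s) : ℂ) - γ.toFun (I t))]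
      obtain ⟨δ, hδ, hB⟩ := Metric.eventually_nhds_iff.1 hbound
      -- The local estimate needs t as one endpoint, so the interval from p to q is split at t.
      refine ⟨δ, hδ, fun p _ q _ hpt htq hp hq => ?_⟩
      have hKη : 0 ≤ K + η :=
        add_nonneg ((norm_nonneg _).trans (hK (I t) hmem.1 hmem.2)) hη0.le
      have hBp := hB (y := p) (by rw [Real.dist_eq, abs_lt]; constructor <;> linarith)
      have hBq := hB (y := q) (by rw [Real.dist_eq, abs_lt]; constructor <;> linarith)
      rw [norm_sub_rev, norm_sub_rev (γ.toFun (I p) : ℂ)] at hBp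
      have := norm_sub_le_norm_sub_add_norm_sub (G (I q)) (G (I t)) (G (I p))
      have h5 := mul_le_mul_of_nonneg_left (hγ.norm_sub_le (hI hpt)) hKη
      have h6 := mul_le_mul_of_nonneg_left (hγ.norm_sub_le (hI htq)) hKη
      linarith
  rw [hIc, hId] at key
  have h7 : f (γ.toFun d) - f (γ.toFun c) - w * ((γ.toFun d : ℂ) - γ.toFun c) = G d - G c := by
    simp only [hG]; ring
  rw [h7]
  have h8 : η * (γ.arcLength d - γ.arcLength c) ≤ ε := by
    rw [hη, div_mul_eq_mul_div, div_le_iff₀ (by positivity)]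
    linarith
  linarith

/-- If the derivatives differ by m at γ(t), nearby they differ by at least m/2, while the increments
of f are the same for both; this forces chords near t to be too short for their arcs. -/
theorem IsLocalDerivative.eq_of_isJordan (hγ : γ.IsRectifiable) (hJ : γ.IsJordan)
    {f g₁ g₂ : C(X, ℂ)} (h₁ : γ.IsLocalDerivative f g₁) (h₂ : γ.IsLocalDerivative f g₂)
    (t : Icc γ.a γ.b) : g₁ (γ.toFun t) = g₂ (γ.toFun t) := by
  by_contra hne
  set m := ‖g₁ (γ.toFun t) - g₂ (γ.toFun t)‖ with hm
  have hm0 : 0 < m := norm_pos_iff.2 (sub_ne_zero.2 hne)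
  -- Two errors m/8 make m/4, which is half of the lower bound m/2 for the difference; hence the
  -- factor 1/2 in `hbound`.
  obtain ⟨δ₁, hδ₁, H₁⟩ := h₁ (m / 8) (by positivity)
  obtain ⟨δ₂, hδ₂, H₂⟩ := h₂ (m / 8) (by positivity)
  obtain ⟨δ₃, hδ₃, H₃⟩ := γ.exists_oscillation_le (g₁ - g₂) (ε := m / 2) (by positivity)
  set δ := min δ₁ (min δ₂ δ₃) with hδ
  have hδ0 : 0 < δ := by positivity
  have hd₁ : δ ≤ δ₁ := min_le_left _ _
  have hd₂ : δ ≤ δ₂ := (min_le_right _ _).trans (min_le_left _ _)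
  have hd₃ : δ ≤ δ₃ := (min_le_right _ _).trans (min_le_right _ _)
  obtain ⟨c, d, hct, htd, hlt, hcd⟩ : ∃ c d : Icc γ.a γ.b, c ≤ t ∧ t ≤ d ∧ c < d ∧
      (d : ℝ) - c < δ := by
    have hab := γ.lt
    have hta := t.2.1
    have htb := t.2.2
    refine ⟨⟨max γ.a (t - δ / 3), le_max_left _ _, max_le hab.le (by linarith)⟩,
      ⟨min γ.b (t + δ / 3), le_min hab.le (by linarith), min_le_left _ _⟩,
      max_le hta (by linarith), le_min htb (by linarith), ?_, ?_⟩
    · exact max_lt (lt_min hab (by linarith)) (lt_min (by linarith) (by linarith))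
    · have h1 := le_max_right γ.a (t - δ / 3)
      have h2 := min_le_right γ.b (t + δ / 3)
      simp only
      linarith
  have hbound : ∀ u v, c ≤ u → u ≤ v → v ≤ d → ‖(γ.toFun v : ℂ) - γ.toFun u‖ ≤
      1 / 2 * γ.arcLength v - 1 / 2 * γ.arcLength u := by
    intro u v hcu huv hvd
    have hcu' : (c : ℝ) ≤ u := hcu
    have hvd' : (v : ℝ) ≤ d := hvd
    have e₁ := H₁ u u v le_rfl huv (by linarith)
    have e₂ := H₂ u u v le_rfl huv (by linarith)
    have e₃ := H₃ c u t d (by linarith) hcu (huv.trans hvd) hct htd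
    simp only [ContinuousMap.sub_apply] at e₃
    have e₄ := norm_sub_norm_le (g₁ (γ.toFun t) - g₂ (γ.toFun t))
      (g₁ (γ.toFun u) - g₂ (γ.toFun u))
    have e₅ := (norm_sub_le _ _).trans (add_le_add e₁ e₂)
    have e₆ : f (γ.toFun v) - f (γ.toFun u) - g₁ (γ.toFun u) * ((γ.toFun v : ℂ) - γ.toFun u) -
        (f (γ.toFun v) - f (γ.toFun u) - g₂ (γ.toFun u) * ((γ.toFun v : ℂ) - γ.toFun u)) =
        -((g₁ (γ.toFun u) - g₂ (γ.toFun u)) * ((γ.toFun v : ℂ) - γ.toFun u)) := by ring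
    rw [e₆, norm_neg, norm_mul] at e₅
    have e₇ : m / 2 * ‖(γ.toFun v : ℂ) - γ.toFun u‖ ≤
        m / 2 * (1 / 2 * γ.arcLength v - 1 / 2 * γ.arcLength u) := by
      have := mul_le_mul_of_nonneg_right (show m / 2 ≤ ‖g₁ (γ.toFun u) - g₂ (γ.toFun u)‖ by
        linarith) (norm_nonneg ((γ.toFun v : ℂ) - γ.toFun u))
      linarith
    exact le_of_mul_le_mul_left e₇ (by positivity)
  -- The arc from c to d is at most half its own length, so its chord vanishes.
  have h1 := hγ.arcLength_sub_le hlt.le (m := fun t => 1 / 2 * γ.arcLength t)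
    (fun u v huv => mul_le_mul_of_nonneg_left (hγ.arcLength_mono huv) (by norm_num)) hbound
  have h2 := hγ.norm_sub_le hlt.le
  have h3 : ‖(γ.toFun d : ℂ) - γ.toFun c‖ ≤ 0 := by linarith
  exact hlt.ne' (hJ (Subtype.ext (sub_eq_zero.1 (norm_le_zero_iff.1 h3))))

/-! ### Rules of differentiation along a path -/

theorem isLocalDerivative_const (hγ : γ.IsRectifiable) (z : ℂ) :
    γ.IsLocalDerivative (algebraMap ℂ C(X, ℂ) z) 0 :=
  fun ε hε => ⟨1, one_pos, fun c s d hs hs' _ => by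
    simpa using mul_nonneg hε.le (sub_nonneg.2 (hγ.arcLength_mono (hs.trans hs')))⟩

theorem isLocalDerivative_id (hγ : γ.IsRectifiable) :
    γ.IsLocalDerivative ⟨Subtype.val, continuous_subtype_val⟩ 1 :=
  fun ε hε => ⟨1, one_pos, fun c s d hs hs' _ => by
    simpa using mul_nonneg hε.le (sub_nonneg.2 (hγ.arcLength_mono (hs.trans hs')))⟩

theorem IsLocalDerivative.add {f₁ f₂ g₁ g₂ : C(X, ℂ)} (h₁ : γ.IsLocalDerivative f₁ g₁)
    (h₂ : γ.IsLocalDerivative f₂ g₂) : γ.IsLocalDerivative (f₁ + f₂) (g₁ + g₂) := by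
  intro ε hε
  obtain ⟨δ₁, hδ₁, H₁⟩ := h₁ (ε / 2) (by positivity)
  obtain ⟨δ₂, hδ₂, H₂⟩ := h₂ (ε / 2) (by positivity)
  refine ⟨min δ₁ δ₂, lt_min hδ₁ hδ₂, fun c s d hs hs' hcd => ?_⟩
  have e₁ := H₁ c s d hs hs' (hcd.trans_le (min_le_left _ _))
  have e₂ := H₂ c s d hs hs' (hcd.trans_le (min_le_right _ _))
  have e := (norm_add_le _ _).trans (add_le_add e₁ e₂)
  simp only [ContinuousMap.add_apply]
  calc _ = _ := by congr 1; ring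
    _ ≤ _ := e
    _ = _ := by ring

theorem IsLocalDerivative.mul [CompactSpace X] (hγ : γ.IsRectifiable) {f₁ f₂ g₁ g₂ : C(X, ℂ)}
    (h₁ : γ.IsLocalDerivative f₁ g₁) (h₂ : γ.IsLocalDerivative f₂ g₂) :
    γ.IsLocalDerivative (f₁ * f₂) (g₁ * f₂ + f₁ * g₂) := by
  intro ε hε
  set M := ‖f₁‖ + ‖f₂‖ + ‖g₁‖ + ‖g₂‖ + 1 with hM
  have hM0 : 0 < M := by positivity
  set η := ε / M with hη
  have hη0 : 0 < η := by positivity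
  obtain ⟨δ₁, hδ₁, H₁⟩ := h₁ η hη0
  obtain ⟨δ₂, hδ₂, H₂⟩ := h₂ η hη0
  obtain ⟨δ₃, hδ₃, H₃⟩ := γ.exists_oscillation_le f₁ hη0
  obtain ⟨δ₄, hδ₄, H₄⟩ := γ.exists_oscillation_le f₂ hη0
  refine ⟨min (min δ₁ δ₂) (min δ₃ δ₄), by positivity, fun c s d hs hs' hcd => ?_⟩
  rw [lt_min_iff, lt_min_iff, lt_min_iff] at hcd
  obtain ⟨⟨hd₁, hd₂⟩, hd₃, hd₄⟩ := hcd
  have hcd := hs.trans hs'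
  have e₁ := H₁ c s d hs hs' hd₁
  have e₂ := H₂ c s d hs hs' hd₂
  have e₃ := H₃ c s d d hd₃ hs hs' hcd le_rfl
  have e₄ := H₄ c s c d hd₄ hs hs' le_rfl hcd
  have e₅ := hγ.norm_sub_le hcd
  have hL : 0 ≤ γ.arcLength d - γ.arcLength c := (norm_nonneg _).trans e₅
  set Δ := (γ.toFun d : ℂ) - γ.toFun c
  set L := γ.arcLength d - γ.arcLength c
  simp only [ContinuousMap.add_apply, ContinuousMap.mul_apply]
  -- Leibniz with f₁ taken at d and f₂ at c; the last two terms move these values to the tag s. The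
  -- four coefficients sum to M - 1.
  have split : f₁ (γ.toFun d) * f₂ (γ.toFun d) - f₁ (γ.toFun c) * f₂ (γ.toFun c) -
      (g₁ (γ.toFun s) * f₂ (γ.toFun s) + f₁ (γ.toFun s) * g₂ (γ.toFun s)) * Δ =
      f₁ (γ.toFun d) * (f₂ (γ.toFun d) - f₂ (γ.toFun c) - g₂ (γ.toFun s) * Δ) +
      f₂ (γ.toFun c) * (f₁ (γ.toFun d) - f₁ (γ.toFun c) - g₁ (γ.toFun s) * Δ) +
      (f₁ (γ.toFun d) - f₁ (γ.toFun s)) * (g₂ (γ.toFun s) * Δ) +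
      (f₂ (γ.toFun c) - f₂ (γ.toFun s)) * (g₁ (γ.toFun s) * Δ) := by ring
  rw [split]
  have b : ∀ {x y : ℂ} {p q : ℝ}, ‖x‖ ≤ p → ‖y‖ ≤ q → ‖x * y‖ ≤ p * q := fun hx hy => by
    rw [norm_mul]
    exact mul_le_mul hx hy (norm_nonneg _) ((norm_nonneg _).trans hx)
  calc _ ≤ ‖f₁‖ * (η * L) + ‖f₂‖ * (η * L) + η * (‖g₂‖ * L) + η * (‖g₁‖ * L) :=
        norm_add_le_of_le (norm_add_le_of_le (norm_add_le_of_le (b (f₁.norm_coe_le_norm _) e₂)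
          (b (f₂.norm_coe_le_norm _) e₁)) (b e₃ (b (g₂.norm_coe_le_norm _) e₅)))
          (b e₄ (b (g₁.norm_coe_le_norm _) e₅))
    _ = (M - 1) * η * L := by rw [hM]; ring
    _ ≤ M * η * L := by gcongr; linarith
    _ = ε * L := by rw [hη]; field_simp

end PlanePath
-- F-derivatives for admissible paths and the Banach function algebra
section FDerivative

variable {X : Set ℂ} {f f₁ f₂ g g₁ g₂ : C(X, ℂ)}

namespace IsFDerivative

theorem meanValueBound (h : IsFDerivative (admissiblePaths X) f g) {γ : PlanePath X}
    (hγ : γ.IsAdmissible) : γ.MeanValueBound f g :=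
  γ.meanValueBound_of_hasIntegral_subpath hγ.1 fun c d hcd =>
    h (γ.subpath c d hcd) (hγ.subpath c d hcd)

theorem isLocalDerivative (h : IsFDerivative (admissiblePaths X) f g) {γ : PlanePath X}
    (hγ : γ.IsAdmissible) : γ.IsLocalDerivative f g :=
  (h.meanValueBound hγ).isLocalDerivative

theorem const (z : ℂ) : IsFDerivative (admissiblePaths X) (algebraMap ℂ C(X, ℂ) z) 0 :=
  fun _ hγ => (PlanePath.isLocalDerivative_const hγ.1 z).hasIntegral hγ.1

theorem id : IsFDerivative (admissiblePaths X) ⟨Subtype.val, continuous_subtype_val⟩ 1 :=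
  fun _ hγ => (PlanePath.isLocalDerivative_id hγ.1).hasIntegral hγ.1

theorem add (h₁ : IsFDerivative (admissiblePaths X) f₁ g₁)
    (h₂ : IsFDerivative (admissiblePaths X) f₂ g₂) :
    IsFDerivative (admissiblePaths X) (f₁ + f₂) (g₁ + g₂) :=
  fun _ hγ => ((h₁.isLocalDerivative hγ).add (h₂.isLocalDerivative hγ)).hasIntegral hγ.1

theorem mul [CompactSpace X] (h₁ : IsFDerivative (admissiblePaths X) f₁ g₁)
    (h₂ : IsFDerivative (admissiblePaths X) f₂ g₂) :
    IsFDerivative (admissiblePaths X) (f₁ * f₂) (g₁ * f₂ + f₁ * g₂) :=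
  fun _ hγ => ((h₁.isLocalDerivative hγ).mul hγ.1 (h₂.isLocalDerivative hγ)).hasIntegral hγ.1

theorem smul [CompactSpace X] (h : IsFDerivative (admissiblePaths X) f g) (z : ℂ) :
    IsFDerivative (admissiblePaths X) (z • f) (z • g) := by
  have := (const (X := X) z).mul h
  rwa [zero_mul, zero_add, ← Algebra.smul_def, ← Algebra.smul_def] at this

theorem sub [CompactSpace X] (h₁ : IsFDerivative (admissiblePaths X) f₁ g₁)
    (h₂ : IsFDerivative (admissiblePaths X) f₂ g₂) :
    IsFDerivative (admissiblePaths X) (f₁ - f₂) (g₁ - g₂) := by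
  simpa [sub_eq_add_neg] using h₁.add (h₂.smul (-1))

/-- The graph of the F-derivative is closed because mean value bounds survive uniform limits. Both
completeness and the description of the completion rest on this. -/
theorem of_mem_closure [CompactSpace X]
    (h : (f, g) ∈ closure {p : C(X, ℂ) × C(X, ℂ) | IsFDerivative (admissiblePaths X) p.1 p.2}) :
    IsFDerivative (admissiblePaths X) f g := by
  intro γ hγ
  refine (PlanePath.MeanValueBound.of_norm_sub_le hγ.1 fun ε hε => ?_).isLocalDerivative.hasIntegral
    hγ.1
  obtain ⟨⟨f', g'⟩, h', hlt⟩ := Metric.mem_closure_iff.1 h ε hε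
  rw [Prod.dist_eq, max_lt_iff, dist_eq_norm, dist_eq_norm] at hlt
  exact ⟨f', g', IsFDerivative.meanValueBound h' hγ,
    fun x => ((f - f').norm_coe_le_norm x).trans hlt.1.le,
    fun x => ((g - g').norm_coe_le_norm x).trans hlt.2.le⟩

theorem unique (hX : IsSemiRectifiable X) (h₁ : IsFDerivative (admissiblePaths X) f g₁)
    (h₂ : IsFDerivative (admissiblePaths X) f g₂) : g₁ = g₂ := by
  refine DFunLike.coe_injective (Continuous.ext_on hX g₁.continuous g₂.continuous fun x hx => ?_)
  simp only [mem_iUnion, mem_range] at hx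
  obtain ⟨γ, ⟨hγ, hJ⟩, t, rfl⟩ := hx
  have hA := hγ.isAdmissible_of_isJordan hJ
  exact (h₁.isLocalDerivative hA).eq_of_isJordan hγ hJ (h₂.isLocalDerivative hA) t

theorem fDeriv_eq (hX : IsSemiRectifiable X) (h : IsFDerivative (admissiblePaths X) f g) :
    fDeriv (admissiblePaths X) f = g := by
  have hex : ∃ g, IsFDerivative (admissiblePaths X) f g := ⟨g, h⟩
  rw [fDeriv, dif_pos hex]
  exact hex.choose_spec.unique hX h

theorem fNorm_eq [CompactSpace X] (hX : IsSemiRectifiable X)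
    (h : IsFDerivative (admissiblePaths X) f g) :
    fNorm (admissiblePaths X) f = ‖f‖ + ‖g‖ := by
  rw [fNorm, h.fDeriv_eq hX]

end IsFDerivative

theorem D1.isFDerivative [CompactSpace X] (f : D1 X) :
    IsFDerivative (admissiblePaths X) (D1.toC f) f.deriv :=
  fun _ hγ => (PlanePath.MeanValueBound.of_hasDerivWithinAt hγ.1
    (fun x => ContDiffAlg.ext_apply _ x.2)
    fun x => (f.isContDiff.1 x x.2).hasDerivWithinAt).isLocalDerivative.hasIntegral hγ.1

theorem isBanachFunctionAlgebra_DF [CompactSpace X] (hX : IsSemiRectifiable X) :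
    IsBanachFunctionAlgebra (DF (admissiblePaths X)) (fNorm (admissiblePaths X)) where
  isSubalgebra := ⟨{ carrier := DF (admissiblePaths X)
                     mul_mem' := fun ⟨_, h₁⟩ ⟨_, h₂⟩ => ⟨_, h₁.mul h₂⟩
                     add_mem' := fun ⟨_, h₁⟩ ⟨_, h₂⟩ => ⟨_, h₁.add h₂⟩
                     algebraMap_mem' := fun z => ⟨0, IsFDerivative.const z⟩ }, rfl⟩
  separates := fun _ _ hxy => ⟨_, ⟨1, IsFDerivative.id⟩, fun h => hxy (Subtype.ext h)⟩
  norm_le := fun f _ => le_add_of_nonneg_right (norm_nonneg _)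
  smul := by
    rintro c f ⟨g, h⟩
    rw [h.fNorm_eq hX, (h.smul c).fNorm_eq hX, norm_smul, norm_smul, mul_add]
  add_le := by
    rintro f ⟨f', hf⟩ g ⟨g', hg⟩
    rw [hf.fNorm_eq hX, hg.fNorm_eq hX, (hf.add hg).fNorm_eq hX]
    linarith [norm_add_le f g, norm_add_le f' g']
  mul_le := by
    rintro f ⟨f', hf⟩ g ⟨g', hg⟩
    rw [hf.fNorm_eq hX, hg.fNorm_eq hX, (hf.mul hg).fNorm_eq hX]
    have h₁ := norm_mul_le f g
    have h₂ := norm_add_le (f' * g) (f * g')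
    have h₃ := norm_mul_le f' g
    have h₄ := norm_mul_le f g'
    have h₅ := mul_nonneg (norm_nonneg f') (norm_nonneg g')
    linarith
  complete := by
    intro u hu hcauchy
    choose u' hu' using hu
    have hN : ∀ m n, fNorm (admissiblePaths X) (u m - u n) = ‖u m - u n‖ + ‖u' m - u' n‖ :=
      fun m n => ((hu' m).sub (hu' n)).fNorm_eq hX
    have hc : CauchySeq u := Metric.cauchySeq_iff.2 fun ε hε => by
      obtain ⟨N, H⟩ := hcauchy ε hε
      refine ⟨N, fun m hm n hn => ?_⟩
      have := H m hm n hn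
      rw [hN] at this
      rw [dist_eq_norm]
      linarith [norm_nonneg (u' m - u' n)]
    have hc' : CauchySeq u' := Metric.cauchySeq_iff.2 fun ε hε => by
      obtain ⟨N, H⟩ := hcauchy ε hε
      refine ⟨N, fun m hm n hn => ?_⟩
      have := H m hm n hn
      rw [hN] at this
      rw [dist_eq_norm]
      linarith [norm_nonneg (u m - u n)]
    obtain ⟨f, hf⟩ := cauchySeq_tendsto_of_complete hc
    obtain ⟨g, hg⟩ := cauchySeq_tendsto_of_complete hc'
    -- The functions and their derivatives converge separately; the closed graph reunites the
    -- limits.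
    have hfg : IsFDerivative (admissiblePaths X) f g := IsFDerivative.of_mem_closure
      (mem_closure_of_tendsto (hf.prodMk_nhds hg) (Eventually.of_forall hu'))
    refine ⟨f, ⟨g, hfg⟩, ?_⟩
    have := (tendsto_iff_norm_sub_tendsto_zero.1 hf).add (tendsto_iff_norm_sub_tendsto_zero.1 hg)
    rw [add_zero] at this
    exact this.congr fun n => (((hu' n).sub hfg).fNorm_eq hX).symm

end FDerivative

/-! ### Semisimplicity and the completion -/

/-- A commutative complex algebra that embeds in an algebra `C(K)` is semisimple. -/
theorem jacobson_eq_bot_of_injective_to_continuousMap {A K : Type*} [CommRing A] [Algebra ℂ A]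
    [TopologicalSpace K] (φ : A →ₐ[ℂ] C(K, ℂ)) (hφ : Function.Injective φ) :
    Ring.jacobson A = ⊥ := by
  rw [eq_bot_iff]
  intro a ha
  rw [Submodule.mem_bot]
  refine hφ (ContinuousMap.ext fun x => ?_)
  set ev : A →ₐ[ℂ] ℂ := (ContinuousMap.evalAlgHom ℂ ℂ x).comp φ
  have hev : Function.Surjective ev := fun z => ⟨algebraMap ℂ A z, ev.commutes z⟩
  -- The kernel of a character is a maximal ideal, so it contains the radical.
  have hmax : (RingHom.ker ev).IsMaximal := RingHom.ker_isMaximal_of_surjective ev hev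
  have : a ∈ RingHom.ker ev := (sInf_le (show RingHom.ker ev ∈ _ from hmax.out)) ha
  rw [map_zero]
  exact this

namespace D1

open UniformSpace

variable {X : Set ℂ} [CompactSpace X]

theorem continuous_toC : Continuous (toC : D1 X → C(X, ℂ)) :=
  AddMonoidHomClass.continuous_of_bound toC 1 fun f => by
    rw [norm_def, one_mul]
    exact le_add_of_nonneg_right (norm_nonneg _)

/-- The derivative as a continuous linear map. -/
def derivCLM (X : Set ℂ) [CompactSpace X] : D1 X →L[ℂ] C(X, ℂ) :=
  LinearMap.mkContinuous ⟨⟨deriv, deriv_add⟩, deriv_smul⟩ 1 fun f => by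
    rw [norm_def, one_mul]
    exact le_add_of_nonneg_left (norm_nonneg _)

/-- The extension of the inclusion `D⁽¹⁾(X) ⊆ C(X)` to the completion. -/
def completionToC (X : Set ℂ) [CompactSpace X] : Completion (D1 X) →ₐ[ℂ] C(X, ℂ) where
  __ := Completion.extensionHom (toC : D1 X →ₐ[ℂ] C(X, ℂ)).toRingHom continuous_toC
  commutes' z := (Completion.extensionHom_coe (toC : D1 X →ₐ[ℂ] C(X, ℂ)).toRingHom continuous_toC
    (algebraMap ℂ (D1 X) z)).trans (toC.commutes z)

theorem completionToC_coe (f : D1 X) : completionToC X (f : Completion (D1 X)) = toC f :=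
  Completion.extensionHom_coe (toC : D1 X →ₐ[ℂ] C(X, ℂ)).toRingHom continuous_toC f

theorem continuous_completionToC : Continuous (completionToC X) :=
  Completion.continuous_extension

/-- The extension of the derivative to the completion of `D⁽¹⁾(X)`. -/
def completionDeriv (X : Set ℂ) [CompactSpace X] : Completion (D1 X) → C(X, ℂ) :=
  Completion.extension (derivCLM X)

theorem completionDeriv_coe (f : D1 X) : completionDeriv X (f : Completion (D1 X)) = f.deriv :=
  Completion.extension_coe (derivCLM X).uniformContinuous f

theorem continuous_completionDeriv : Continuous (completionDeriv X) :=
  Completion.continuous_extension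

/-- The pair depends continuously on u and lies in the closed graph for u in the dense subalgebra.
-/
theorem isFDerivative_completion (u : Completion (D1 X)) :
    IsFDerivative (admissiblePaths X) (completionToC X u) (completionDeriv X u) := by
  refine IsFDerivative.of_mem_closure ?_
  have hc : Continuous fun u => (completionToC X u, completionDeriv X u) :=
    continuous_completionToC.prodMk continuous_completionDeriv
  refine map_mem_closure (f := fun u => (completionToC X u, completionDeriv X u)) hc
    (Completion.denseRange_coe u) ?_
  rintro _ ⟨f, rfl⟩
  simpa only [mem_ofPred_eq, completionToC_coe, completionDeriv_coe] using f.isFDerivative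

theorem norm_completion (u : Completion (D1 X)) :
    ‖u‖ = ‖completionToC X u‖ + ‖completionDeriv X u‖ := by
  induction u using Completion.induction_on with
  | hp =>
    exact isClosed_eq continuous_norm
      (continuous_completionToC.norm.add continuous_completionDeriv.norm)
  | ih f => rw [Completion.norm_coe, completionToC_coe, completionDeriv_coe, norm_def]

theorem fNorm_completionToC (hX : IsSemiRectifiable X) (u : Completion (D1 X)) :
    fNorm (admissiblePaths X) (completionToC X u) = ‖u‖ := by
  rw [(isFDerivative_completion u).fNorm_eq hX, norm_completion]

/-- Semi-rectifiability is decisive here: if the limit function is 0, uniqueness makes the limit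
derivative 0 as well, and the norm sees nothing else. -/
theorem completionToC_injective (hX : IsSemiRectifiable X) :
    Function.Injective (completionToC X) := by
  refine (injective_iff_map_eq_zero _).2 fun u hu => ?_
  rw [← norm_eq_zero, ← fNorm_completionToC hX, hu, ← map_zero (completionToC X),
    fNorm_completionToC hX, norm_zero]

end D1

end

theorem mainTheorem6 (X : Set ℂ) [CompactSpace X] (hX : IsSemiRectifiable X) :
    Ring.jacobson (UniformSpace.Completion (D1 X)) = ⊥ ∧
    (∀ f g₁ g₂ : C(X, ℂ), IsFDerivative (admissiblePaths X) f g₁ →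
      IsFDerivative (admissiblePaths X) f g₂ → g₁ = g₂) ∧
    IsBanachFunctionAlgebra (DF (admissiblePaths X)) (fNorm (admissiblePaths X)) ∧
    ∃ φ : UniformSpace.Completion (D1 X) →ₐ[ℂ] C(X, ℂ),
      (∀ f : D1 X, φ (f : UniformSpace.Completion (D1 X)) = D1.toC f) ∧
      (∀ u, φ u ∈ DF (admissiblePaths X)) ∧
      (∀ u, fNorm (admissiblePaths X) (φ u) = ‖u‖) :=
  ⟨jacobson_eq_bot_of_injective_to_continuousMap _ (D1.completionToC_injective hX),
    fun _ _ _ h₁ h₂ => h₁.unique hX h₂, isBanachFunctionAlgebra_DF hX,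
    D1.completionToC X, D1.completionToC_coe, fun u => ⟨_, D1.isFDerivative_completion u⟩,
    D1.fNorm_completionToC hX⟩
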